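/- For $z\in\mathbb{C}$ let $[z]=\lfloor \operatorname{Re} z+\tfrac12\rfloor+i\lfloor \operatorname{Im} z+\tfrac12\rfloor\in\mathbb{Z}[i]$. For $z\in\mathbb{C}\setminus\mathbb{Q}(i)$ the Hurwitz continued fraction $z=[a_0;a_1,a_2,\ldots]$ is the infinite sequence of Gaussian integers given by $a_0=[z]$, $z_1=z-a_0$ and, for $n\ge 1$, $a_n=[1/z_n]$, $z_{n+1}=1/z_n-a_n$ (all $z_n$ are non-zero because $z\notin\mathbb{Q}(i)$). Then the Hausdorff dimension of the set of complex numbers whose Hurwitz continued fraction has elements tending to infinity in absolute value is $$\dim_H\Bigl\{z=[a_0;a_1,a_2,\ldots]\in\mathbb{C}\setminus\mathbb{Q}(i) : \lim_{n\to\infty}|a_n|=+\infty\Bigr\}=1 .$$ -/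

import Mathlib

open Filter Topology

namespace HurwitzCF

/-- The nearest-integer function `[z] = ⌊Re z + 1/2⌋ + i ⌊Im z + 1/2⌋` from `ℂ` to `ℤ[i]`. -/
noncomputable def nearest (z : ℂ) : GaussianInt :=
  ⟨⌊z.re + 1 / 2⌋, ⌊z.im + 1 / 2⌋⟩

/-- The field `ℚ(i)`, as a subfield of `ℂ`. -/
noncomputable abbrev gaussianRationals : IntermediateField ℚ ℂ :=
  IntermediateField.adjoin ℚ {Complex.I}

/-- The Hurwitz map `T z = 1 / z - [1 / z]`; it is meant for `z ≠ 0`. -/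
noncomputable def hurwitzMap (z : ℂ) : ℂ := z⁻¹ - (nearest z⁻¹ : ℂ)

/-- The iterates of the Hurwitz map, starting from `w - [w]`: in the usual one-based indexing
`remainder w n` is `z_{n+1}`, where `z_1 = w - [w]` and `z_{n+1} = T z_n`. They are non-zero for
`w ∉ ℚ(i)`, see `remainder_ne_zero`, so that the algorithm never stops for such `w`. -/
noncomputable def remainder (w : ℂ) : ℕ → ℂ
  | 0 => w - (nearest w : ℂ)
  | n + 1 => hurwitzMap (remainder w n)

/-- The elements `a_0 = [w]`, `a_n = [1 / z_n]` (`n ≥ 1`) of the Hurwitz continued fraction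
`[a_0; a_1, a_2, …]` of a complex number `w ∉ ℚ(i)`. -/
noncomputable def element (w : ℂ) : ℕ → GaussianInt
  | 0 => nearest w
  | n + 1 => nearest (remainder w n)⁻¹

theorem gaussianInt_mem (a : GaussianInt) : (a : ℂ) ∈ gaussianRationals := by
  rw [GaussianInt.toComplex_def]
  exact add_mem (intCast_mem _ _) (mul_mem (intCast_mem _ _)
    (IntermediateField.subset_adjoin ℚ _ (Set.mem_singleton _)))

theorem sub_gaussianInt_notMem {z : ℂ} (hz : z ∉ gaussianRationals) (a : GaussianInt) :
    z - (a : ℂ) ∉ gaussianRationals := fun h =>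
  hz (by simpa using add_mem h (gaussianInt_mem a))

theorem remainder_notMem {w : ℂ} (hw : w ∉ gaussianRationals) (n : ℕ) :
    remainder w n ∉ gaussianRationals := by
  induction n with
  | zero => exact sub_gaussianInt_notMem hw _
  | succ n ih =>
    refine sub_gaussianInt_notMem (fun h => ih ?_) _
    simpa using inv_mem h

/-- For `w ∉ ℚ(i)` every step of the Hurwitz algorithm is defined. -/
theorem remainder_ne_zero {w : ℂ} (hw : w ∉ gaussianRationals) (n : ℕ) :
    remainder w n ≠ 0 := fun h =>
  remainder_notMem hw n (h ▸ zero_mem _)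

end HurwitzCF

/-!
The dimension is at most `1`: from some index on, all elements of a point of the set have absolute
value at least `M`, and the remainders from there on lie in `largeElements M`. This set is covered by
its own images under the maps `w ↦ (a + w)⁻¹` with `‖a‖ ≥ M`, whose contraction ratios are about
`‖a‖ ^ (-2)`. For `s > 1` the sum of `‖a‖ ^ (-2 * s)` over the Gaussian integers converges, so its
tail is less than `1` for large `M`, and iterating the covering gives
`dimH (largeElements M) ≤ s` (`dimH_le_of_subset_iUnion_image`). Passing from the remainders back to
the points uses countably many locally Lipschitz maps (`dimH_remainder_preimage_le`).

The dimension is at least `1`: every sequence of elements with `‖a n‖ ≥ 4` occurs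
(`exists_isTailSeq`), and the resulting number is not in `ℚ(i)` by infinite descent. Let the `n`-th
element range over the `(n + 4) ^ 2` Gaussian integers of a square of side `n + 4`, chosen by the
digits of `t ∈ [0, 1)` in the Cantor series with bases `(n + 4) ^ 2`. This gives a map `t ↦ z(t)` into
the set. If the digits of `t` and `t'` first differ at `n`, then `|t - t'|` is at most the product of
`(k + 4) ^ (-2)` over `k < n` (`prod_mul_abs_sub_le_one`), while `‖z(t) - z(t')‖` is at least a constant
times the product of `(5 * (k + 4)) ^ (-2)` over `k ≤ n` (`inv_prod_le_norm_sub`). The two products have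
the same logarithmic size, so the inverse of `t ↦ z(t)` is Hölder continuous of every exponent `s < 1`,
and `1 = dimH [0, 1) ≤ dimH / s`.
-/

section

open MeasureTheory NNReal ENNReal Set

/-! ### Sets covered by contracted copies of themselves -/

/-- The images of `F` under the `n`-fold compositions of the `f i` form a covering of `F` whose
`s`-dimensional size is at most the `n`-th power of `∑ c i ^ s`. -/
theorem exists_cover_of_subset_iUnion_image {X ι : Type} [EMetricSpace X] [Countable ι]
    {F : Set X} {f : ι → X → X} {c : ι → ℝ≥0} {s : ℝ} (hs : 0 < s)
    (hf : ∀ i, LipschitzOnWith (c i) (f i) F) (hF : F ⊆ ⋃ i, f i '' F) (n : ℕ) :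
    ∃ (κ : Type) (_ : Countable κ) (t : κ → Set X), (∀ k, t k ⊆ F) ∧ (F ⊆ ⋃ k, t k) ∧
      ∑' k, Metric.ediam (t k) ^ s ≤
        (∑' i, (c i : ℝ≥0∞) ^ s) ^ n * Metric.ediam F ^ s := by
  induction n with
  | zero => exact ⟨Unit, inferInstance, fun _ => F, by simp, by simp [iUnion_const], by simp⟩
  | succ n ih =>
    obtain ⟨κ, _, t, htF, hFt, hsum⟩ := ih
    refine ⟨ι × κ, inferInstance, fun k => f k.1 '' t k.2 ∩ F, fun k => inter_subset_right, ?_, ?_⟩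
    · intro x hx
      obtain ⟨i, y, hy, rfl⟩ := mem_iUnion.1 (hF hx)
      obtain ⟨k, hk⟩ := mem_iUnion.1 (hFt hy)
      exact mem_iUnion.2 ⟨(i, k), ⟨y, hk, rfl⟩, hx⟩
    · have key : ∀ i k, Metric.ediam (f i '' t k ∩ F) ^ s ≤
          (c i : ℝ≥0∞) ^ s * Metric.ediam (t k) ^ s := by
        intro i k
        rw [← ENNReal.mul_rpow_of_nonneg _ _ hs.le]
        exact ENNReal.rpow_le_rpow ((Metric.ediam_mono inter_subset_left).trans
          (by simpa using ((hf i).mono (htF k)).holderOnWith.ediam_image_le)) hs.le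
      calc ∑' k : ι × κ, Metric.ediam (f k.1 '' t k.2 ∩ F) ^ s
          = ∑' i, ∑' k, Metric.ediam (f i '' t k ∩ F) ^ s := ENNReal.tsum_prod'
        _ ≤ ∑' i, ∑' k, (c i : ℝ≥0∞) ^ s * Metric.ediam (t k) ^ s :=
          ENNReal.tsum_le_tsum fun i => ENNReal.tsum_le_tsum fun k => key i k
        _ = (∑' i, (c i : ℝ≥0∞) ^ s) * ∑' k, Metric.ediam (t k) ^ s := by
          simp_rw [ENNReal.tsum_mul_left, ENNReal.tsum_mul_right]
        _ ≤ _ := by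
          rw [pow_succ', mul_assoc]
          gcongr

/-- A bounded set covered by countably many images of itself under maps with Lipschitz constants
`c i` has dimension at most `s` as soon as `∑ c i ^ s < 1`. -/
theorem dimH_le_of_subset_iUnion_image {X ι : Type} [EMetricSpace X] [Countable ι]
    {F : Set X} {f : ι → X → X} {c : ι → ℝ≥0} {s : ℝ≥0} (hs : 0 < s)
    (hf : ∀ i, LipschitzOnWith (c i) (f i) F) (hF : F ⊆ ⋃ i, f i '' F)
    (hb : Metric.ediam F ≠ ∞) (hsum : ∑' i, (c i : ℝ≥0∞) ^ (s : ℝ) < 1) : dimH F ≤ s := by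
  borelize X
  have hs' : (0 : ℝ) < s := hs
  choose κ hκ t _ hFt ht using exists_cover_of_subset_iUnion_image hs' hf hF
  set q := ∑' i, (c i : ℝ≥0∞) ^ (s : ℝ)
  have hlim : Tendsto (fun n : ℕ => q ^ n * Metric.ediam F ^ (s : ℝ)) atTop (𝓝 0) := by
    have := ENNReal.Tendsto.mul_const (tendsto_pow_atTop_nhds_zero_of_lt_one hsum)
      (b := Metric.ediam F ^ (s : ℝ)) (Or.inr (ENNReal.rpow_ne_top_of_nonneg hs'.le hb))
    simpa using this
  have hlim' : Tendsto (fun n : ℕ => (q ^ n * Metric.ediam F ^ (s : ℝ)) ^ (1 / (s : ℝ)))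
      atTop (𝓝 0) := by
    have := (ENNReal.continuous_rpow_const (y := 1 / (s : ℝ))).tendsto 0 |>.comp hlim
    rwa [ENNReal.zero_rpow_of_pos (by positivity)] at this
  have h0 : μH[(s : ℝ)] F ≤ 0 := by
    refine (Measure.hausdorffMeasure_le_liminf_tsum s F _ hlim' t
      (.of_forall fun n k => ?_) (.of_forall hFt)).trans ?_
    · rw [one_div, ENNReal.le_rpow_inv_iff hs']
      exact (ENNReal.le_tsum k).trans (ht n)
    · rw [← hlim.liminf_eq]
      exact liminf_le_liminf (.of_forall ht)
  exact dimH_le_of_hausdorffMeasure_ne_top (by simp [nonpos_iff_eq_zero.1 h0])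

namespace HurwitzCF

instance : Countable GaussianInt :=
  Function.Injective.countable (f := fun a : GaussianInt => (a.re, a.im)) fun a b h => by
    simp only [Prod.mk.injEq] at h
    exact Zsqrtd.ext h.1 h.2

/-! ### Upper bound for the dimension -/

theorem norm_sub_nearest_le (z : ℂ) : ‖z - (nearest z : ℂ)‖ ≤ 3 / 4 := by
  have h1 := Int.floor_le (z.re + 1 / 2)
  have h2 := Int.lt_floor_add_one (z.re + 1 / 2)
  have h3 := Int.floor_le (z.im + 1 / 2)
  have h4 := Int.lt_floor_add_one (z.im + 1 / 2)
  rw [← abs_of_nonneg (norm_nonneg _), ← abs_of_nonneg (by norm_num : (0:ℝ) ≤ 3 / 4), ← sq_le_sq,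
    Complex.sq_norm, Complex.normSq_apply]
  simp only [nearest, Complex.sub_re, Complex.sub_im, GaussianInt.re_toComplex,
    GaussianInt.im_toComplex]
  nlinarith

/-- The points `w` close to `0` such that the Hurwitz map, iterated from `w` itself, yields only
elements of absolute value at least `M`. The radius `3 / 4 > 1 / √2` makes every remainder of the
algorithm a candidate. -/
def largeElements (M : ℝ) : Set ℂ :=
  {w | ‖w‖ ≤ 3 / 4 ∧ ∀ n, M ≤ ‖(nearest (hurwitzMap^[n] w)⁻¹ : ℂ)‖}

/-- The self-covering by inverse branches of the Hurwitz map. -/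
theorem largeElements_subset_iUnion (M : ℝ) :
    largeElements M ⊆ ⋃ a : {a : GaussianInt // M ≤ ‖(a : ℂ)‖},
      (fun w : ℂ => ((a : GaussianInt) + w)⁻¹) '' largeElements M := by
  rintro w ⟨_, hw⟩
  refine mem_iUnion.2 ⟨⟨nearest w⁻¹, hw 0⟩, hurwitzMap w,
    ⟨norm_sub_nearest_le _, fun n => hw (n + 1)⟩, ?_⟩
  simp [hurwitzMap]

theorem lipschitzOnWith_inv_add {M : ℝ} (a : ℂ) (ha : 1 < ‖a‖) :
    LipschitzOnWith ((‖a‖₊ - 3 / 4) ^ (-2 : ℝ)) (fun w : ℂ => (a + w)⁻¹) (largeElements M) := by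
  have hpos : 0 < ‖a‖ - 3 / 4 := by linarith
  have hcoe : (((‖a‖₊ - 3 / 4) ^ (-2 : ℝ) : ℝ≥0) : ℝ) = ((‖a‖ - 3 / 4) ^ 2)⁻¹ := by
    rw [NNReal.coe_rpow, NNReal.coe_sub (by rw [← NNReal.coe_le_coe]; push_cast; linarith)]
    push_cast
    rw [Real.rpow_neg hpos.le]
    norm_num
  have hlow : ∀ w ∈ largeElements M, ‖a‖ - 3 / 4 ≤ ‖a + w‖ := by
    intro w hw
    have := norm_sub_norm_le a (-w)
    rw [sub_neg_eq_add, norm_neg] at this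
    linarith [hw.1]
  refine LipschitzOnWith.of_dist_le_mul fun x hx y hy => ?_
  have h1 := hlow x hx
  have h2 := hlow y hy
  have hx0 : a + x ≠ 0 := norm_pos_iff.1 (by linarith)
  have hy0 : a + y ≠ 0 := norm_pos_iff.1 (by linarith)
  rw [hcoe, dist_eq_norm, dist_eq_norm, inv_sub_inv hx0 hy0, norm_div, norm_mul,
    add_sub_add_left_eq_sub, norm_sub_rev, div_eq_inv_mul]
  gcongr
  nlinarith

theorem summable_norm_rpow_neg {k : ℝ} (hk : 2 < k) :
    Summable fun a : GaussianInt => ‖(a : ℂ)‖ ^ (-k) := by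
  have h := EisensteinSeries.summable_one_div_norm_rpow hk
  have hinj : Function.Injective fun a : GaussianInt => (![a.re, a.im] : Fin 2 → ℤ) := by
    intro a b hab
    exact Zsqrtd.ext (by simpa using congrFun hab 0) (by simpa using congrFun hab 1)
  refine (h.comp_injective hinj).of_nonneg_of_le (fun a => by positivity) fun a => ?_
  have hle : ‖(![a.re, a.im] : Fin 2 → ℤ)‖ ≤ ‖(a : ℂ)‖ := by
    rw [pi_norm_le_iff_of_nonneg (norm_nonneg _)]
    intro i
    fin_cases i
    · simpa [Int.norm_eq_abs, GaussianInt.intCast_re] using Complex.abs_re_le_norm (a : ℂ)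
    · simpa [Int.norm_eq_abs, GaussianInt.intCast_im] using Complex.abs_im_le_norm (a : ℂ)
  rcases eq_or_ne a 0 with rfl | ha
  · have : (![(0 : GaussianInt).re, (0 : GaussianInt).im] : Fin 2 → ℤ) = 0 := by
      ext i; fin_cases i <;> rfl
    have h0 : ‖((0 : GaussianInt) : ℂ)‖ =
        ‖(![(0 : GaussianInt).re, (0 : GaussianInt).im] : Fin 2 → ℤ)‖ := by
      rw [this]; simp
    exact (congrArg (· ^ (-k)) h0).le
  · exact Real.rpow_le_rpow_of_nonpos (norm_pos_iff.2 fun h0 => ha (hinj (by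
      rw [h0]; ext i; fin_cases i <;> rfl))) hle (by linarith)

/-- For `s > 1` the `s`-th powers of the contraction ratios `(‖a‖ - 3 / 4) ^ (-2)` are summable over
the Gaussian integers, so that the sum over large `a` is small. -/
theorem exists_tsum_lt_one {s : ℝ} (hs : 1 < s) :
    ∃ M : ℝ, 3 ≤ M ∧ ∑' a : {a : GaussianInt // M ≤ ‖(a : ℂ)‖},
      (((‖(a : ℂ)‖₊ - 3 / 4) ^ (-2 : ℝ) : ℝ≥0) : ℝ≥0∞) ^ s < 1 := by
  -- On the index sets in question `‖a‖ - 3 / 4 ≥ ‖a‖ / 2`.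
  set g : GaussianInt → ℝ≥0 := fun a => (‖(a : ℂ)‖₊ / 2) ^ (-(2 * s)) with hg
  have hgs : Summable g := by
    rw [← NNReal.summable_coe]
    refine ((summable_norm_rpow_neg (by linarith : 2 < 2 * s)).mul_right
      ((1 / 2 : ℝ) ^ (-(2 * s)))).congr fun a => ?_
    rw [hg, ← Real.mul_rpow (by positivity) (by positivity)]
    push_cast
    congr 1
    ring
  have htop : ∑' a, (g a : ℝ≥0∞) ≠ ∞ := ENNReal.tsum_coe_ne_top_iff_summable.2 hgs
  have hlim := ENNReal.tendsto_tsum_compl_atTop_zero htop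
  obtain ⟨S, hS⟩ := (hlim.eventually_lt_const one_pos).exists
  obtain ⟨B, hB⟩ := (S.image fun a : GaussianInt => ‖(a : ℂ)‖).bddAbove
  have hBS : ∀ a ∈ S, ‖(a : ℂ)‖ ≤ B := fun a ha => hB (by
    rw [Finset.mem_coe]; exact Finset.mem_image_of_mem _ ha)
  refine ⟨max 3 (B + 1), le_max_left _ _, lt_of_le_of_lt ?_ hS⟩
  have hsub : ∀ a : {a : GaussianInt // max 3 (B + 1) ≤ ‖(a : ℂ)‖}, (a : GaussianInt) ∉ S := by
    intro a ha
    linarith [hBS _ ha, le_max_right 3 (B + 1), a.2]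
  let e : {a : GaussianInt // max 3 (B + 1) ≤ ‖(a : ℂ)‖} → {a : GaussianInt // a ∉ S} :=
    fun a => ⟨a, hsub a⟩
  have he : Function.Injective e := fun a b hab => Subtype.ext (by simpa [e] using hab)
  refine le_trans (ENNReal.tsum_le_tsum fun a => ?_)
    (ENNReal.tsum_comp_le_tsum_of_injective he fun a => (g a : ℝ≥0∞))
  rw [← ENNReal.coe_rpow_of_nonneg _ (by linarith), ENNReal.coe_le_coe, ← NNReal.rpow_mul]
  have h3 : (3 : ℝ) ≤ ‖((a : GaussianInt) : ℂ)‖ := (le_max_left _ _).trans a.2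
  have hle : ‖((a : GaussianInt) : ℂ)‖₊ / 2 ≤ ‖((a : GaussianInt) : ℂ)‖₊ - 3 / 4 := by
    rw [← NNReal.coe_le_coe,
      NNReal.coe_sub (by rw [← NNReal.coe_le_coe]; push_cast; linarith)]
    push_cast
    linarith
  have hpos : 0 < ‖((a : GaussianInt) : ℂ)‖₊ / 2 := by
    rw [← NNReal.coe_pos]; push_cast; linarith
  rw [← NNReal.coe_le_coe, NNReal.coe_rpow, NNReal.coe_rpow, neg_mul]
  exact Real.rpow_le_rpow_of_nonpos (NNReal.coe_pos.2 hpos) (NNReal.coe_le_coe.2 hle) (by linarith)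

theorem exists_dimH_largeElements_le {s : ℝ≥0} (hs : 1 < s) :
    ∃ M : ℝ, dimH (largeElements M) ≤ s := by
  obtain ⟨M, hM, hsum⟩ := exists_tsum_lt_one (s := s) (by exact_mod_cast hs)
  refine ⟨M, dimH_le_of_subset_iUnion_image (zero_lt_one.trans hs)
    (fun a => lipschitzOnWith_inv_add _ (by linarith [a.2])) (largeElements_subset_iUnion M)
    ?_ hsum⟩
  exact ((Metric.isBounded_closedBall (x := (0 : ℂ)) (r := 3 / 4)).subset fun w hw => by
    simpa using hw.1).ediam_ne_top

/-- The inverse branches of `z ↦ remainder z n` are countably many locally Lipschitz maps. -/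
theorem dimH_remainder_preimage_le (S : Set ℂ) (n : ℕ) :
    dimH {z : ℂ | remainder z n ∈ S} ≤ dimH S := by
  induction n generalizing S with
  | zero =>
    have hsub : {z : ℂ | remainder z 0 ∈ S} ⊆
        ⋃ a : GaussianInt, (fun w : ℂ => (a : ℂ) + w) '' S := fun z hz =>
      mem_iUnion.2 ⟨nearest z, z - nearest z, hz, by simp⟩
    refine (dimH_mono hsub).trans ?_
    rw [dimH_iUnion]
    exact iSup_le fun a => ((isometry_add_left (a : ℂ)).dimH_image S).le
  | succ n ih =>
    set S' : Set ℂ := {0} ∪ ⋃ a : GaussianInt,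
      (fun w : ℂ => ((a : ℂ) + w)⁻¹) '' (S \ {-(a : ℂ)}) with hS'
    have hsub : {z : ℂ | remainder z (n + 1) ∈ S} ⊆ {z : ℂ | remainder z n ∈ S'} := by
      intro z hz
      by_cases h0 : remainder z n = 0
      · exact Or.inl h0
      · refine Or.inr (mem_iUnion.2 ⟨nearest (remainder z n)⁻¹, remainder z (n + 1), ⟨hz, ?_⟩, ?_⟩)
        · simpa [remainder, hurwitzMap, sub_eq_iff_eq_add] using h0
        · simp [remainder, hurwitzMap]
    refine (dimH_mono hsub).trans ((ih S').trans ?_)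
    rw [hS', dimH_union, dimH_singleton, dimH_iUnion]
    refine max_le zero_le (iSup_le fun a => ?_)
    refine (dimH_image_le_of_locally_lipschitzOn fun x hx => ?_).trans (dimH_mono sdiff_subset)
    have hx0 : (a : ℂ) + x ≠ 0 := fun h => hx.2 (eq_neg_of_add_eq_zero_right h)
    have hd : ContDiffAt ℝ 1 (fun w : ℂ => ((a : ℂ) + w)⁻¹) x :=
      (contDiffAt_const.add contDiffAt_id).inv hx0
    obtain ⟨K, t, ht, hK⟩ := hd.exists_lipschitzOnWith
    exact ⟨K, t, mem_nhdsWithin_of_mem_nhds ht, hK⟩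

theorem iterate_hurwitzMap_remainder (z : ℂ) (m n : ℕ) :
    hurwitzMap^[n] (remainder z m) = remainder z (m + n) := by
  induction n with
  | zero => rfl
  | succ n ih => rw [Function.iterate_succ_apply', ih]; rfl

theorem norm_remainder_le (z : ℂ) : ∀ n, ‖remainder z n‖ ≤ 3 / 4
  | 0 => norm_sub_nearest_le _
  | _ + 1 => norm_sub_nearest_le _

theorem dimH_tendsto_le_one :
    dimH {z : ℂ | z ∉ gaussianRationals ∧
      Tendsto (fun n : ℕ => ‖(element z n : ℂ)‖) atTop atTop} ≤ 1 := by
  refine le_of_forall_gt fun r hr => ?_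
  obtain ⟨s, hs1, hsr⟩ := ENNReal.lt_iff_exists_nnreal_btwn.1 hr
  obtain ⟨M, hM⟩ := exists_dimH_largeElements_le (s := s) (by exact_mod_cast hs1)
  refine lt_of_le_of_lt ?_ hsr
  have hsub : {z : ℂ | z ∉ gaussianRationals ∧
      Tendsto (fun n : ℕ => ‖(element z n : ℂ)‖) atTop atTop} ⊆
      ⋃ m : ℕ, {z : ℂ | remainder z m ∈ largeElements M} := by
    rintro z ⟨_, hz⟩
    obtain ⟨m, hm⟩ := eventually_atTop.1 (hz.eventually_ge_atTop M)
    refine mem_iUnion.2 ⟨m, norm_remainder_le z m, fun n => ?_⟩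
    rw [iterate_hurwitzMap_remainder]
    exact hm (m + n + 1) (by omega)
  refine (dimH_mono hsub).trans ?_
  rw [dimH_iUnion]
  exact iSup_le fun m => (dimH_remainder_preimage_le _ m).trans hM

end HurwitzCF

/-! ### Maps with a Hölder continuous inverse -/

/-- If the inverse of `g` is Hölder continuous of exponent `r` on `g '' S`, then `g` shrinks the
dimension of `S` at most by the factor `r`. -/
theorem dimH_le_dimH_image_div {X Y : Type*} [MetricSpace X] [MetricSpace Y] [Nonempty X]
    {g : X → Y} {S : Set X} {C r : ℝ≥0} (hr : 0 < r)
    (h : ∀ x ∈ S, ∀ y ∈ S, dist x y ≤ C * dist (g x) (g y) ^ (r : ℝ)) :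
    dimH S ≤ dimH (g '' S) / r := by
  set f := Function.invFunOn g S
  have hf : ∀ u ∈ g '' S, f u ∈ S ∧ g (f u) = u := fun u hu =>
    ⟨Function.invFunOn_mem hu, Function.invFunOn_eq hu⟩
  have hH : HolderOnWith C r f (g '' S) := by
    intro u hu v hv
    obtain ⟨hu1, hu2⟩ := hf u hu
    obtain ⟨hv1, hv2⟩ := hf v hv
    have := h _ hu1 _ hv1
    rw [hu2, hv2] at this
    rw [edist_nndist, edist_nndist, ← ENNReal.coe_rpow_of_nonneg _ r.coe_nonneg]
    exact_mod_cast this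
  have hsub : S ⊆ f '' (g '' S) := by
    refine fun x hx => ⟨g x, mem_image_of_mem g hx, ?_⟩
    obtain ⟨h1, h2⟩ := hf (g x) (mem_image_of_mem g hx)
    have := h _ h1 _ hx
    rw [h2, dist_self, Real.zero_rpow (NNReal.coe_pos.2 hr).ne', mul_zero] at this
    exact dist_le_zero.1 this
  exact (dimH_mono hsub).trans (hH.dimH_image_le hr)

namespace HurwitzCF

/-! ### Continued fractions with prescribed large elements -/

theorem exists_div_of_mem_gaussianRationals {z : ℂ} (hz : z ∈ gaussianRationals) :
    ∃ p q : GaussianInt, q ≠ 0 ∧ z = (p : ℂ) / q := by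
  induction hz using IntermediateField.adjoin_induction with
  | mem x hx =>
    rw [mem_singleton_iff] at hx
    exact ⟨⟨0, 1⟩, 1, one_ne_zero, by simp [hx, GaussianInt.toComplex_def]⟩
  | algebraMap x =>
    refine ⟨(x.num : GaussianInt), (x.den : GaussianInt), ?_, ?_⟩
    · intro h
      have h1 := congrArg GaussianInt.toComplex h
      rw [map_natCast, map_zero, Nat.cast_eq_zero] at h1
      exact x.den_nz h1
    · rw [map_intCast, map_natCast, eq_ratCast, Rat.cast_def]
  | add x y _ _ hx hy =>
    obtain ⟨p, q, hq, rfl⟩ := hx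
    obtain ⟨p', q', hq', rfl⟩ := hy
    refine ⟨p * q' + q * p', q * q', mul_ne_zero hq hq', ?_⟩
    rw [div_add_div _ _ (mt GaussianInt.toComplex_eq_zero.1 hq)
      (mt GaussianInt.toComplex_eq_zero.1 hq')]
    simp
  | inv x _ hx =>
    obtain ⟨p, q, hq, rfl⟩ := hx
    by_cases hp : p = 0
    · exact ⟨0, 1, one_ne_zero, by simp [hp]⟩
    · exact ⟨q, p, hp, by simp⟩
  | mul x y _ _ hx hy =>
    obtain ⟨p, q, hq, rfl⟩ := hx
    obtain ⟨p', q', hq', rfl⟩ := hy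
    exact ⟨p * p', q * q', mul_ne_zero hq hq', by simp [div_mul_div_comm]⟩

/-- `w n` is the value of the continued fraction `[0; a n, a (n + 1), …]`. The bound on `w n`
singles out the values that the Hurwitz algorithm can produce. -/
def IsTailSeq (a : ℕ → GaussianInt) (w : ℕ → ℂ) : Prop :=
  ∀ n, ‖w n‖ ≤ 1 / 3 ∧ ((a n : ℂ) + w (n + 1)) * w n = 1

namespace IsTailSeq

variable {a a' : ℕ → GaussianInt} {w w' : ℕ → ℂ}

theorem ne_zero (h : IsTailSeq a w) (n : ℕ) : w n ≠ 0 := fun h0 => by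
  simpa [h0] using (h n).2

theorem inv_eq (h : IsTailSeq a w) (n : ℕ) : (w n)⁻¹ = (a n : ℂ) + w (n + 1) :=
  (eq_inv_of_mul_eq_one_left (h n).2).symm

/-- If `w n = p / q`, then `w (n + 1)` has denominator `p`, which is smaller than `q`. -/
theorem notMem_gaussianRationals (h : IsTailSeq a w) : w 0 ∉ gaussianRationals := by
  intro hmem
  -- The norm of the denominator cannot decrease indefinitely.
  have descent : ∀ (N n : ℕ) (p q : GaussianInt), q ≠ 0 → q.norm.natAbs < N →
      w n ≠ (p : ℂ) / q := by
    intro N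
    induction N with
    | zero => intro _ _ _ _ hlt; omega
    | succ N ih =>
      intro n p q hq hlt heq
      have hq' : (q : ℂ) ≠ 0 := mt GaussianInt.toComplex_eq_zero.1 hq
      have hp : p ≠ 0 := by
        rintro rfl
        exact h.ne_zero n (by simp [heq])
      have hp' : (p : ℂ) ≠ 0 := mt GaussianInt.toComplex_eq_zero.1 hp
      refine ih (n + 1) (q - a n * p) p hp ?_ ?_
      · have h1 : ‖(p : ℂ)‖ < ‖(q : ℂ)‖ := by
          have h2 := (h n).1
          rw [heq, norm_div, div_le_iff₀ (norm_pos_iff.2 hq')] at h2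
          linarith [norm_pos_iff.2 hq']
        have h3 : (p.norm : ℝ) < q.norm := by
          rw [GaussianInt.intCast_real_norm, GaussianInt.intCast_real_norm,
            Complex.normSq_eq_norm_sq, Complex.normSq_eq_norm_sq]
          gcongr
        have h4 : p.norm < q.norm := by exact_mod_cast h3
        have := GaussianInt.norm_nonneg p
        omega
      · have := h.inv_eq n
        rw [heq, inv_div] at this
        rw [eq_sub_of_add_eq' this.symm]
        simp only [map_sub, map_mul]
        field_simp
  obtain ⟨p, q, hq, hz⟩ := exists_div_of_mem_gaussianRationals hmem
  exact descent _ 0 p q hq (Nat.lt_succ_self _) hz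

end IsTailSeq

theorem nearest_add_of_norm_le (a : GaussianInt) {w : ℂ} (hw : ‖w‖ ≤ 1 / 3) :
    nearest (a + w) = a := by
  have h1 := abs_le.1 ((Complex.abs_re_le_norm w).trans hw)
  have h2 := abs_le.1 ((Complex.abs_im_le_norm w).trans hw)
  apply Zsqrtd.ext
  · simp only [nearest, Complex.add_re, ← GaussianInt.intCast_re]
    rw [Int.floor_eq_iff]
    constructor <;> linarith
  · simp only [nearest, Complex.add_im, ← GaussianInt.intCast_im]
    rw [Int.floor_eq_iff]
    constructor <;> linarith

namespace IsTailSeq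

variable {a a' : ℕ → GaussianInt} {w w' : ℕ → ℂ}

theorem remainder_eq (h : IsTailSeq a w) (n : ℕ) : remainder (w 0) n = w n := by
  induction n with
  | zero =>
    have := nearest_add_of_norm_le 0 (h 0).1
    rw [map_zero, zero_add] at this
    simp [remainder, this]
  | succ n ih =>
    rw [remainder, ih, hurwitzMap, h.inv_eq, nearest_add_of_norm_le _ (h (n + 1)).1,
      add_sub_cancel_left]

theorem element_succ (h : IsTailSeq a w) (n : ℕ) : element (w 0) (n + 1) = a n := by
  rw [element, h.remainder_eq, h.inv_eq, nearest_add_of_norm_le _ (h (n + 1)).1]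

theorem norm_sub_eq (h : IsTailSeq a w) (h' : IsTailSeq a' w') (n : ℕ) :
    ‖w n - w' n‖ =
      ‖((a n : ℂ) + w (n + 1)) - (a' n + w' (n + 1))‖ * (‖w n‖ * ‖w' n‖) := by
  rw [← h.inv_eq, ← h'.inv_eq, inv_sub_inv (h.ne_zero n) (h'.ne_zero n), norm_div, norm_mul,
    norm_sub_rev, div_mul_cancel₀]
  exact (mul_pos (norm_pos_iff.2 (h.ne_zero n)) (norm_pos_iff.2 (h'.ne_zero n))).ne'

theorem inv_le_norm (h : IsTailSeq a w) {n : ℕ} {R : ℝ} (hR : 1 ≤ R) (ha : ‖(a n : ℂ)‖ ≤ 4 * R) :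
    (5 * R)⁻¹ ≤ ‖w n‖ := by
  rw [inv_le_comm₀ (by positivity) (norm_pos_iff.2 (h.ne_zero n)), ← norm_inv, h.inv_eq]
  linarith [norm_add_le (a n : ℂ) (w (n + 1)), (h (n + 1)).1]

/-- Points whose elements first differ at the index `n` are not too close to each other. -/
theorem inv_prod_le_norm_sub (h : IsTailSeq a w) (h' : IsTailSeq a' w') {R : ℕ → ℝ}
    (hR : ∀ n, 1 ≤ R n) (ha : ∀ n, ‖(a n : ℂ)‖ ≤ 4 * R n) (ha' : ∀ n, ‖(a' n : ℂ)‖ ≤ 4 * R n)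
    {n : ℕ} (heq : ∀ k < n, a k = a' k) (hne : a n ≠ a' n) :
    (3 * ∏ k ∈ Finset.range (n + 1), (5 * R k) ^ 2)⁻¹ ≤ ‖w 0 - w' 0‖ := by
  have hstep : ∀ k, ((5 * R k) ^ 2)⁻¹ ≤ ‖w k‖ * ‖w' k‖ := by
    intro k
    rw [sq, mul_inv]
    have h0 : 0 < 5 * R k := by linarith [hR k]
    exact mul_le_mul (h.inv_le_norm (hR k) (ha k)) (h'.inv_le_norm (hR k) (ha' k))
      (inv_pos.2 h0).le (norm_nonneg _)
  have hone : 1 ≤ ‖(a n : ℂ) - a' n‖ := by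
    have h1 : 0 < (a n - a' n).norm := GaussianInt.norm_pos.2 (sub_ne_zero.2 hne)
    have h2 : (1 : ℝ) ≤ (a n - a' n).norm := by exact_mod_cast h1
    rw [GaussianInt.intCast_real_norm, Complex.normSq_eq_norm_sq, map_sub] at h2
    exact (one_le_sq_iff₀ (norm_nonneg _)).1 h2
  have hn : 3⁻¹ * ((5 * R n) ^ 2)⁻¹ ≤ ‖w n - w' n‖ := by
    rw [h.norm_sub_eq h']
    refine mul_le_mul ?_ (hstep n) (by positivity) (norm_nonneg _)
    have := norm_sub_norm_le ((a n : ℂ) - a' n) (w' (n + 1) - w (n + 1))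
    rw [show (a n : ℂ) - a' n - (w' (n + 1) - w (n + 1)) =
      (a n + w (n + 1)) - (a' n + w' (n + 1)) by ring] at this
    linarith [norm_sub_le (w' (n + 1)) (w (n + 1)), (h (n + 1)).1, (h' (n + 1)).1]
  have hind : ∀ m ≤ n, (∏ k ∈ Finset.range m, ((5 * R k) ^ 2)⁻¹) * ‖w m - w' m‖ ≤
      ‖w 0 - w' 0‖ := by
    intro m
    induction m with
    | zero => simp
    | succ m ih =>
      intro hm
      refine le_trans ?_ (ih (by omega))
      rw [Finset.prod_range_succ, mul_assoc, h.norm_sub_eq h' m, heq m (by omega),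
        add_sub_add_left_eq_sub, mul_comm (((5 * R m) ^ 2)⁻¹)]
      gcongr
      exact hstep m
  refine le_trans ?_ (hind n le_rfl)
  rw [Finset.prod_range_succ, mul_inv, mul_inv, Finset.prod_inv_distrib, mul_left_comm]
  gcongr

end IsTailSeq

/-- Every sequence of elements of absolute value at least `4` is admissible for the Hurwitz
algorithm. -/
theorem exists_isTailSeq {a : ℕ → GaussianInt} (ha : ∀ n, 4 ≤ ‖(a n : ℂ)‖) :
    ∃ w, IsTailSeq a w := by
  -- Finitely many of the equations can be solved backwards; a compactness argument gives the rest.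
  have hfin : ∀ (n : ℕ) (a : ℕ → GaussianInt), (∀ n, 4 ≤ ‖(a n : ℂ)‖) → ∃ w : ℕ → ℂ,
      (∀ k, ‖w k‖ ≤ 1 / 3) ∧ ∀ k < n, ((a k : ℂ) + w (k + 1)) * w k = 1 := by
    intro n
    induction n with
    | zero => exact fun a _ => ⟨0, by simp, by simp⟩
    | succ n ih =>
      intro a ha
      obtain ⟨w, hw, hw'⟩ := ih (fun k => a (k + 1)) fun k => ha (k + 1)
      have hlow : 3 ≤ ‖(a 0 : ℂ) + w 0‖ := by
        have := norm_sub_norm_le (a 0 : ℂ) (-w 0)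
        rw [sub_neg_eq_add, norm_neg] at this
        linarith [hw 0, ha 0]
      refine ⟨fun k => Nat.casesOn k ((a 0 : ℂ) + w 0)⁻¹ w, ?_, ?_⟩
      · rintro (_ | k)
        · change ‖((a 0 : ℂ) + w 0)⁻¹‖ ≤ 1 / 3
          rw [norm_inv, one_div]
          gcongr
        · exact hw k
      · rintro (_ | k) hk
        · exact mul_inv_cancel₀ (norm_pos_iff.1 (by linarith))
        · exact hw' k (by omega)
  set B : Set (ℕ → ℂ) := univ.pi fun _ => Metric.closedBall 0 (1 / 3)
  have hB : IsCompact B := isCompact_univ_pi fun _ => isCompact_closedBall _ _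
  have hcl : ∀ k, IsClosed {w : ℕ → ℂ | ((a k : ℂ) + w (k + 1)) * w k = 1} := fun k =>
    isClosed_eq (by fun_prop) continuous_const
  have hmem : ∀ w : ℕ → ℂ, w ∈ B ↔ ∀ k, ‖w k‖ ≤ 1 / 3 := by
    intro w
    simp [B]
  obtain ⟨w, hw⟩ := IsCompact.nonempty_iInter_of_sequence_nonempty_isCompact_isClosed
    (fun n => B ∩ ⋂ k, ⋂ (_ : k < n), {w : ℕ → ℂ | ((a k : ℂ) + w (k + 1)) * w k = 1})
    (fun n w hw => ⟨hw.1, mem_iInter₂.2 fun k hk => mem_iInter₂.1 hw.2 k (by omega)⟩)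
    (fun n => by
      obtain ⟨w, h1, h2⟩ := hfin n a ha
      exact ⟨w, (hmem w).2 h1, mem_iInter₂.2 h2⟩)
    (by simpa using hB)
    (fun n => hB.isClosed.inter (isClosed_iInter fun k => isClosed_iInter fun _ => hcl k))
  rw [mem_iInter] at hw
  exact ⟨w, fun n => ⟨(hmem w).1 (hw 0).1 n, mem_iInter₂.1 (hw (n + 1)).2 n (by omega)⟩⟩

/-! ### Cantor series -/

/-- The `n`-th remainder of the Cantor series expansion of `t` in the bases `N 0, N 1, …`. -/
noncomputable def cantorRest (N : ℕ → ℕ) (t : ℝ) : ℕ → ℝ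
  | 0 => t
  | n + 1 => Int.fract (N n * cantorRest N t n)

/-- The `n`-th digit of the Cantor series expansion of `t` in the bases `N 0, N 1, …`, an element of
`{0, …, N n - 1}` if `t ∈ [0, 1)`. -/
noncomputable def cantorDigit (N : ℕ → ℕ) (t : ℝ) (n : ℕ) : ℕ :=
  ⌊N n * cantorRest N t n⌋₊

section Cantor

variable {N : ℕ → ℕ} {t t' : ℝ}

theorem cantorRest_mem (ht : t ∈ Ico (0 : ℝ) 1) : ∀ n, cantorRest N t n ∈ Ico (0 : ℝ) 1
  | 0 => ht
  | _ + 1 => ⟨Int.fract_nonneg _, Int.fract_lt_one _⟩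

theorem cantorDigit_lt (hN : ∀ n, 0 < N n) (ht : t ∈ Ico (0 : ℝ) 1) (n : ℕ) :
    cantorDigit N t n < N n := by
  have h := cantorRest_mem (N := N) ht n
  have hN' : (0 : ℝ) < N n := by exact_mod_cast hN n
  exact (Nat.floor_lt (mul_nonneg hN'.le h.1)).2 (by nlinarith [h.2])

theorem mul_cantorRest (ht : t ∈ Ico (0 : ℝ) 1) (n : ℕ) :
    N n * cantorRest N t n = cantorDigit N t n + cantorRest N t (n + 1) := by
  have h : 0 ≤ N n * cantorRest N t n :=
    mul_nonneg (Nat.cast_nonneg _) (cantorRest_mem ht n).1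
  rw [cantorDigit, cantorRest, natCast_floor_eq_intCast_floor h, Int.floor_add_fract]

theorem prod_mul_abs_sub_le_one (ht : t ∈ Ico (0 : ℝ) 1) (ht' : t' ∈ Ico (0 : ℝ) 1) {n : ℕ}
    (h : ∀ k < n, cantorDigit N t k = cantorDigit N t' k) :
    (∏ k ∈ Finset.range n, (N k : ℝ)) * |t - t'| ≤ 1 := by
  have key : ∀ m ≤ n, (∏ k ∈ Finset.range m, (N k : ℝ)) * (t - t') =
      cantorRest N t m - cantorRest N t' m := by
    intro m
    induction m with
    | zero => simp [cantorRest]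
    | succ m ih =>
      intro hm
      rw [Finset.prod_range_succ, mul_right_comm, ih (by omega), mul_comm, mul_sub,
        mul_cantorRest ht, mul_cantorRest ht', h m (by omega)]
      ring
  have h1 := cantorRest_mem (N := N) ht n
  have h2 := cantorRest_mem (N := N) ht' n
  have hP : 0 ≤ ∏ k ∈ Finset.range n, (N k : ℝ) :=
    Finset.prod_nonneg fun k _ => Nat.cast_nonneg (N k)
  rw [← abs_of_nonneg hP, ← abs_mul, key n le_rfl, abs_le]
  constructor <;> linarith [h1.1, h1.2, h2.1, h2.2]

theorem exists_cantorDigit_ne (hN : ∀ n, 2 ≤ N n) (ht : t ∈ Ico (0 : ℝ) 1)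
    (ht' : t' ∈ Ico (0 : ℝ) 1) (hne : t ≠ t') : ∃ n, cantorDigit N t n ≠ cantorDigit N t' n := by
  by_contra! h
  have hpos : 0 < |t - t'| := abs_pos.2 (sub_ne_zero.2 hne)
  obtain ⟨n, hn⟩ := pow_unbounded_of_one_lt (1 / |t - t'|) (one_lt_two : (1 : ℝ) < 2)
  have h1 := prod_mul_abs_sub_le_one ht ht' (n := n) fun k _ => h k
  have h2 : (2 : ℝ) ^ n ≤ ∏ k ∈ Finset.range n, (N k : ℝ) := by
    rw [← Finset.card_range n, ← Finset.prod_const, Finset.card_range]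
    exact Finset.prod_le_prod (fun _ _ => zero_le_two) fun k _ => by exact_mod_cast hN k
  rw [div_lt_iff₀ hpos] at hn
  nlinarith

end Cantor

/-! ### Lower bound for the dimension -/

/-- The `d`-th Gaussian integer, `d < R ^ 2`, in the square `[R, 2 R) × [R, 2 R)`. -/
def squareElement (R d : ℕ) : GaussianInt :=
  ⟨(R + d / R : ℕ), (R + d % R : ℕ)⟩

theorem squareElement_injective (R : ℕ) : Function.Injective (squareElement R) := by
  intro d e h
  simp only [squareElement, Zsqrtd.ext_iff, Nat.cast_inj] at h
  rw [← Nat.div_add_mod d R, ← Nat.div_add_mod e R, Nat.add_left_cancel h.1,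
    Nat.add_left_cancel h.2]

theorem le_norm_squareElement (R d : ℕ) : (R : ℝ) ≤ ‖(squareElement R d : ℂ)‖ := by
  refine le_trans ?_ (Complex.re_le_norm _)
  rw [← GaussianInt.intCast_re, squareElement]
  change (R : ℝ) ≤ ((R + d / R : ℕ) : ℤ)
  exact_mod_cast Nat.le_add_right R (d / R)

theorem norm_squareElement_le {R d : ℕ} (hd : d < R ^ 2) :
    ‖(squareElement R d : ℂ)‖ ≤ 4 * R := by
  have hR : 0 < R := Nat.pos_of_ne_zero fun h => by simp [h] at hd
  have h1 : ((d / R : ℕ) : ℝ) ≤ R := by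
    exact_mod_cast (Nat.div_lt_of_lt_mul (by rwa [← sq])).le
  have h2 : ((d % R : ℕ) : ℝ) ≤ R := by exact_mod_cast (Nat.mod_lt d hR).le
  refine (Complex.norm_le_abs_re_add_abs_im _).trans ?_
  rw [← GaussianInt.intCast_re, ← GaussianInt.intCast_im, squareElement]
  simp only [Int.cast_natCast, Nat.abs_cast]
  push_cast
  linarith

/-- As the factors `(n + 4) ^ 2` tend to infinity, but only polynomially, neither the constant `25`
nor the additional factor on the left matters for an exponent `s < 1`. -/
theorem exists_prod_rpow_le {s : ℝ} (hs : 0 < s) (hs1 : s < 1) : ∃ C : ℝ, 0 < C ∧ ∀ n : ℕ,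
    (∏ k ∈ Finset.range (n + 1), (5 * ((k + 4 : ℕ) : ℝ)) ^ 2) ^ s ≤
      C * ∏ k ∈ Finset.range n, (((k + 4) ^ 2 : ℕ) : ℝ) := by
  set Q : ℕ → ℝ := fun n => ∏ k ∈ Finset.range n, (5 * ((k + 4 : ℕ) : ℝ)) ^ 2 with hQ
  set P : ℕ → ℝ := fun n => ∏ k ∈ Finset.range n, (((k + 4) ^ 2 : ℕ) : ℝ) with hP
  have hQpos : ∀ n, 0 < Q n := fun n => Finset.prod_pos fun k _ => by positivity
  have hPpos : ∀ n, 0 < P n := fun n => Finset.prod_pos fun k _ => by positivity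
  have hratio : ∀ᶠ n : ℕ in atTop,
      ((5 * ((n + 1 + 4 : ℕ) : ℝ)) ^ 2) ^ s ≤ (((n + 4) ^ 2 : ℕ) : ℝ) := by
    have hlim : Tendsto (fun n : ℕ => ((n : ℝ) + 4) ^ (2 * (1 - s))) atTop atTop :=
      (_root_.tendsto_rpow_atTop (by linarith)).comp
        (tendsto_atTop_add_const_right _ _ tendsto_natCast_atTop_atTop)
    filter_upwards [hlim.eventually_ge_atTop ((100 : ℝ) ^ s)] with n hn
    have h0 : (0 : ℝ) < n + 4 := by positivity
    have hle : (5 * ((n + 1 + 4 : ℕ) : ℝ)) ^ 2 ≤ 100 * ((n : ℝ) + 4) ^ 2 := by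
      push_cast
      nlinarith [(Nat.cast_nonneg n : (0 : ℝ) ≤ n)]
    calc ((5 * ((n + 1 + 4 : ℕ) : ℝ)) ^ 2) ^ s ≤ (100 * ((n : ℝ) + 4) ^ 2) ^ s :=
          Real.rpow_le_rpow (by positivity) hle hs.le
      _ = 100 ^ s * ((n : ℝ) + 4) ^ (2 * s) := by
          rw [Real.mul_rpow (by norm_num) (by positivity), ← Real.rpow_natCast,
            ← Real.rpow_mul h0.le]
          norm_num
      _ ≤ ((n : ℝ) + 4) ^ (2 * (1 - s)) * ((n : ℝ) + 4) ^ (2 * s) := by gcongr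
      _ = (((n + 4) ^ 2 : ℕ) : ℝ) := by
          rw [← Real.rpow_add h0, show 2 * (1 - s) + 2 * s = (2 : ℕ) by push_cast; ring,
            Real.rpow_natCast]
          push_cast
          ring
  obtain ⟨m, hm⟩ := eventually_atTop.1 hratio
  obtain ⟨C, hC⟩ := ((Finset.range (m + 1)).image fun n => Q (n + 1) ^ s / P n).bddAbove
  have hC' : ∀ n ≤ m, Q (n + 1) ^ s / P n ≤ C := fun n hn => hC (by
    rw [Finset.mem_coe]
    exact Finset.mem_image_of_mem (fun n => Q (n + 1) ^ s / P n) (Finset.mem_range.2 (by omega)))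
  have hCpos : 0 < C :=
    (div_pos (Real.rpow_pos_of_pos (hQpos _) _) (hPpos 0)).trans_le (hC' 0 (Nat.zero_le _))
  -- From `m` on, the quotient `Q (n + 1) ^ s / P n` is nonincreasing.
  refine ⟨C, hCpos, fun n => ?_⟩
  change Q (n + 1) ^ s ≤ C * P n
  rcases le_total n m with hn | hn
  · exact (div_le_iff₀ (hPpos n)).1 (hC' n hn)
  · induction n, hn using Nat.le_induction with
    | base => exact (div_le_iff₀ (hPpos m)).1 (hC' m le_rfl)
    | succ n hn ih =>
      have e1 : Q (n + 1 + 1) = Q (n + 1) * (5 * ((n + 1 + 4 : ℕ) : ℝ)) ^ 2 :=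
        Finset.prod_range_succ _ _
      have e2 : P (n + 1) = P n * (((n + 4) ^ 2 : ℕ) : ℝ) := Finset.prod_range_succ _ _
      rw [e1, e2, Real.mul_rpow (hQpos _).le (by positivity), ← mul_assoc]
      exact mul_le_mul ih (hm n hn) (by positivity) (mul_pos hCpos (hPpos n)).le

theorem le_dimH_tendsto {s : ℝ≥0} (hs : 0 < s) (hs1 : s < 1) :
    (s : ℝ≥0∞) ≤ dimH {z : ℂ | z ∉ gaussianRationals ∧
      Tendsto (fun n : ℕ => ‖(element z n : ℂ)‖) atTop atTop} := by
  -- Expand `t` in the bases `(n + 4) ^ 2` and let the `n`-th digit pick one of the `(n + 4) ^ 2`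
  -- Gaussian integers in a square of side `n + 4`.
  set N : ℕ → ℕ := fun n => (n + 4) ^ 2 with hN
  set a : ℝ → ℕ → GaussianInt := fun t n => squareElement (n + 4) (cantorDigit N t n) with ha
  have hNpos : ∀ n, 0 < N n := fun n => by positivity
  have hlow : ∀ t n, ((n + 4 : ℕ) : ℝ) ≤ ‖(a t n : ℂ)‖ := fun t n => le_norm_squareElement _ _
  have hup : ∀ t ∈ Ico (0 : ℝ) 1, ∀ n, ‖(a t n : ℂ)‖ ≤ 4 * ((n + 4 : ℕ) : ℝ) := fun t ht n =>
    norm_squareElement_le (cantorDigit_lt hNpos ht n)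
  have hex : ∀ t, ∃ w, IsTailSeq (a t) w := fun t => exists_isTailSeq fun n =>
    le_trans (by push_cast; linarith [(Nat.cast_nonneg n : (0 : ℝ) ≤ n)]) (hlow t n)
  choose w hw using hex
  have hsub : (fun t => w t 0) '' Ico (0 : ℝ) 1 ⊆ {z : ℂ | z ∉ gaussianRationals ∧
      Tendsto (fun n : ℕ => ‖(element z n : ℂ)‖) atTop atTop} := by
    rintro _ ⟨t, _, rfl⟩
    refine ⟨(hw t).notMem_gaussianRationals, (tendsto_add_atTop_iff_nat 1).1 ?_⟩
    simp_rw [(hw t).element_succ]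
    exact tendsto_atTop_mono (hlow t)
      (tendsto_natCast_atTop_atTop.comp (tendsto_add_atTop_nat 4))
  obtain ⟨C, hC, hprod⟩ := exists_prod_rpow_le (s := s) hs hs1
  have hholder : ∀ t ∈ Ico (0 : ℝ) 1, ∀ t' ∈ Ico (0 : ℝ) 1, dist t t' ≤
      ((C * 3 ^ (s : ℝ)).toNNReal : ℝ) * dist (w t 0) (w t' 0) ^ (s : ℝ) := by
    intro t ht t' ht'
    rw [Real.coe_toNNReal _ (by positivity)]
    rcases eq_or_ne t t' with rfl | hne
    · rw [dist_self]
      positivity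
    -- Compare both distances through the first index `n` at which the digits differ.
    have hdiff := exists_cantorDigit_ne (N := N) (fun n => (by omega : 2 ≤ n + 4).trans
      (Nat.le_self_pow two_ne_zero _)) ht ht' hne
    classical
    have heq : ∀ k < Nat.find hdiff, cantorDigit N t k = cantorDigit N t' k := fun k hk =>
      not_not.1 (Nat.find_min hdiff hk)
    have hn := Nat.find_spec hdiff
    set n := Nat.find hdiff
    have h1 := prod_mul_abs_sub_le_one ht ht' heq
    have h2 := (hw t).inv_prod_le_norm_sub (hw t') (R := fun n => ((n + 4 : ℕ) : ℝ))
      (fun n => by push_cast; linarith [(Nat.cast_nonneg n : (0 : ℝ) ≤ n)]) (hup t ht) (hup t' ht')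
      (fun k hk => congrArg (squareElement (k + 4)) (heq k hk))
      (fun h => hn (squareElement_injective _ h))
    have h3 := hprod n
    set Q : ℝ := ∏ k ∈ Finset.range (n + 1), (5 * ((k + 4 : ℕ) : ℝ)) ^ 2
    set P : ℝ := ∏ k ∈ Finset.range n, (((k + 4) ^ 2 : ℕ) : ℝ)
    have hQ : 0 < Q := Finset.prod_pos fun k _ => by positivity
    have hP : 0 < P := Finset.prod_pos fun k _ => by positivity
    rw [dist_eq_norm (w t 0), Real.dist_eq]
    have h4 : 1 ≤ (3 * ‖w t 0 - w t' 0‖) ^ (s : ℝ) * Q ^ (s : ℝ) := by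
      rw [← Real.mul_rpow (by positivity) hQ.le]
      refine Real.one_le_rpow ?_ hs.le
      rw [inv_le_iff_one_le_mul₀ (by positivity)] at h2
      linarith
    rw [Real.mul_rpow (by norm_num) (norm_nonneg _)] at h4
    have h5 : P * |t - t'| ≤ P * (C * 3 ^ (s : ℝ) * ‖w t 0 - w t' 0‖ ^ (s : ℝ)) := by
      refine (h1.trans h4).trans ?_
      have : 0 ≤ 3 ^ (s : ℝ) * ‖w t 0 - w t' 0‖ ^ (s : ℝ) := by positivity
      nlinarith
    exact le_of_mul_le_mul_left h5 hP
  have hdim := (dimH_le_dimH_image_div hs hholder).trans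
    (ENNReal.div_le_div_right (dimH_mono hsub) _)
  rw [Real.dimH_of_nonempty_interior (by simp), Module.finrank_self, Nat.cast_one] at hdim
  rwa [ENNReal.le_div_iff_mul_le (Or.inl (by exact_mod_cast hs.ne')) (Or.inl (by simp)),
    one_mul] at hdim

end HurwitzCF

end

theorem theorem1p3 :
    dimH {z : ℂ | z ∉ HurwitzCF.gaussianRationals ∧
      Tendsto (fun n : ℕ => ‖(HurwitzCF.element z n : ℂ)‖) atTop atTop} = 1 := by
  refine le_antisymm HurwitzCF.dimH_tendsto_le_one (le_of_forall_lt fun r hr => ?_)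
  obtain ⟨s, hrs, hs1⟩ := ENNReal.lt_iff_exists_nnreal_btwn.1 hr
  exact hrs.trans_le (HurwitzCF.le_dimH_tendsto (by exact_mod_cast pos_of_gt hrs)
    (by exact_mod_cast hs1))
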